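/- Let $f:\mathbb{R}^D\to\mathbb{R}$ be twice differentiable and non-negative with $f^*:=\inf f=0$. Let $p,q\in[1,\infty]$ with $\frac1p+\frac1q=1$, let $H_0,H_1\ge 0$, $\mu>0$, $\tau\in(0,1]$, and suppose that for all $\theta\in\mathbb{R}^D$ $$\|\nabla^2 f(\theta)\|_{p\to q}\le H_0+H_1 f(\theta)\quad(\mathsf{NS}),\qquad \|\nabla f(\theta)\|_q\ge \mu\,[f(\theta)-f^*]^{\tau}\quad(\mathsf{NL}),$$ where $\|A\|_{p\to q}=\max_{\|x\|_p\le 1}\|Ax\|_q$. Let $\beta\in(0,1)$ and let $\theta_1\in\mathbb{R}^D$ with $f(\theta_1)\le F$. Consider deterministic diagonal RMSProp with $\delta=0$ and a constant step size $\eta$: for $t\ge1$ and every coordinate $i$, $$\theta_{t+1,i}=\theta_{t,i}-\eta\,\frac{g_{t,i}}{\sqrt{v_{t,i}}},\qquad g_t=\nabla f(\theta_t),\qquad v_{t,i}=(1-\beta)\sum_{s=1}^{t}\beta^{t-s}g_{s,i}^2,$$ with $0/0$ read as $0$. Then there are constants $\eta_1,a,c,C>0$ that depend only on $H_0,H_1,\mu,\tau,\beta,F,p$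 and, unless $(p,q)=(\infty,1)$, on an upper bound $N$ for $D$ (so for $(p,q)=(\infty,1)$ they do not depend on the dimension), such that for every $\epsilon>0$: - If $\epsilon>H_0/H_1$ (that is, $H_0<\epsilon H_1$), then with the step size $\eta=\eta_1$, $f(\theta_{T+1})\le\epsilon$ for every integer $T\ge C\,\bigl(1+\max\{0,\ln(1/\epsilon)\}\bigr)$; that is, after $O(\ln(1/\epsilon))$ iterations with an $O(1)$ step. - Otherwise (that is, $\epsilon H_1\le H_0$), with the step size $\eta=\min\{a,\,c\,\epsilon^{2\tau}\}=O(\epsilon^{2\tau})$, $f(\theta_{T+1})\le\epsilon$ - for every integer $T\ge C\,\epsilon^{-2\tau}$, if $\tau\le\frac12$; - for every integer $T\ge C\,\epsilon^{-(4\tau-1)}$, if $\tau>\frac12$. -/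

import Mathlib

open scoped ENNReal Gradient

noncomputable section

/-- The `ℓ_p` norm of a vector of `ℝ^D`, for `p ∈ [1, ∞]`. -/
def vecNorm {D : ℕ} (p : ℝ≥0∞) (x : EuclideanSpace ℝ (Fin D)) : ℝ :=
  ‖(WithLp.toLp p x.ofLp : PiLp p fun _ : Fin D => ℝ)‖

/-- The induced operator norm `‖A‖_{p → q} = max { ‖A x‖_q : ‖x‖_p ≤ 1 }`. -/
def opNorm {D : ℕ} (p q : ℝ≥0∞)
    (A : EuclideanSpace ℝ (Fin D) →L[ℝ] EuclideanSpace ℝ (Fin D)) : ℝ :=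
  sSup {r : ℝ | ∃ x : EuclideanSpace ℝ (Fin D), vecNorm p x ≤ 1 ∧ r = vecNorm q (A x)}

/-- The Hessian of `f` at `θ`: the derivative of the gradient, `x ↦ ∇²f(θ) x`. -/
def hessian {D : ℕ} (f : EuclideanSpace ℝ (Fin D) → ℝ) (θ : EuclideanSpace ℝ (Fin D)) :
    EuclideanSpace ℝ (Fin D) →L[ℝ] EuclideanSpace ℝ (Fin D) :=
  fderiv ℝ (∇ f) θ

/-- `f` is twice differentiable (no continuity of the Hessian is asked for) and non-negative. -/
def TwiceDiffNonneg {D : ℕ} (f : EuclideanSpace ℝ (Fin D) → ℝ) : Prop :=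
  Differentiable ℝ f ∧ Differentiable ℝ (∇ f) ∧ ∀ θ, 0 ≤ f θ

/-- `(H₀, H₁)` non-uniform smoothness with respect to the pair `(p, q)`. -/
def NonUniformSmooth {D : ℕ} (p q : ℝ≥0∞) (H₀ H₁ : ℝ)
    (f : EuclideanSpace ℝ (Fin D) → ℝ) : Prop :=
  ∀ θ, opNorm p q (hessian f θ) ≤ H₀ + H₁ * f θ

/-- The non-uniform Łojasiewicz condition, with `f^* = inf f`. -/
def NonUniformLojasiewicz {D : ℕ} (q : ℝ≥0∞) (τ : ℝ)
    (μ : EuclideanSpace ℝ (Fin D) → ℝ) (f : EuclideanSpace ℝ (Fin D) → ℝ) : Prop :=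
  ∀ θ, 0 < μ θ ∧ μ θ * (f θ - ⨅ x, f x) ^ τ ≤ vecNorm q (∇ f θ)

/-- The second-moment accumulator `v_{t,i} = (1 - β) ∑_{s=1}^t β^{t-s} (∇f(θ_s))_i²`. -/
def rmsV {D : ℕ} (f : EuclideanSpace ℝ (Fin D) → ℝ) (β : ℝ)
    (θ : ℕ → EuclideanSpace ℝ (Fin D)) (t : ℕ) (i : Fin D) : ℝ :=
  (1 - β) * ∑ s ∈ Finset.Icc 1 t, β ^ (t - s) * (∇ f (θ s)) i ^ 2

/-- `θ 1, θ 2, …` are iterates of deterministic diagonal RMSProp with parameters `β`, `δ` and step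
sizes `η 1, η 2, …` (the value `θ 0` is not used).  If `δ = 0` and `v_{t,i} = 0` then the gradients
seen so far vanish in coordinate `i`, and the quotient `0 / 0` is read as `0`: coordinate `i`
does not move. -/
def IsRMSProp {D : ℕ} (f : EuclideanSpace ℝ (Fin D) → ℝ) (β δ : ℝ) (η : ℕ → ℝ)
    (θ : ℕ → EuclideanSpace ℝ (Fin D)) : Prop :=
  ∀ t : ℕ, 1 ≤ t → ∀ i : Fin D,
    θ (t + 1) i = θ t i - η t * ((∇ f (θ t)) i / (√(rmsV f β θ t i) + δ))

end

/-!
The proof works with the pair `(∞, 1)` throughout: for another pair, the `∞ → 1` norm of the Hessian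
is bounded by `N²` times its `p → q` norm, which rescales `H₀` and `H₁` by the same factor, and the
`ℓ_q` norm of the gradient is at most its `ℓ₁` norm (`NonUniformSmooth.selfBounded`).

The Hessian at `θ` is bounded by the weight `h = H₀ + H₁ f`. Along a line in a direction of sup norm
one, `h'' ≤ H₁ h`, and a non-negative function with this property satisfies `|h'| ≤ √H₁ h`
(`neg_mul_le_deriv_of_deriv2_le`). Hence `h` changes by a factor of at most `e^{√H₁ r}` over a distance
`r` (`SelfBounded.weight_le`). This gives a descent inequality and a Lipschitz bound for the gradient in
which only the weight at the starting point occurs.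

Each coordinate of an RMSProp step is at most `r = η / √(1 - β)`, so the gradient `j` steps ago differs
from the current one, `g`, by at most `j r e^{√H₁ r j} h`. As `√vᵢ ≤ ∑ √β^j |g_{t-j,i}|`, the geometric
weights give `∑ √vᵢ ≤ S (‖g‖₁ + r h)` with `S` depending on `β` only. By Cauchy–Schwarz the first-order
decrease `η ∑ gᵢ² / √vᵢ` is at least `η ‖g‖₁² / ∑ √vᵢ`, which is of order `η ‖g‖₁` as soon as `η h` is
small compared with `‖g‖₁` (`exists_rmsProp_descent`). So `f` decreases by a multiple of
`η ‖g‖₁ ≥ η μ f^τ` while `f` is above `ε / 2`, and below `ε / 2` a step cannot lift it above `ε`.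

If `H₀ < ε H₁`, then `h` is of order `f` above `ε / 2`, a constant step is allowed, and `f` decreases
geometrically (`le_of_linear_decrease`). Otherwise the step is `c ε^{2τ}`. For `τ < 1/2` the hypotheses
force `f = 0` (`SelfBounded.eq_zero_of_lojasiewicz`). For `τ ≥ 1/2`, `f^τ ≥ ε^{τ - 1/2} √f`, so `√f`
decreases by a multiple of `η ε^{τ - 1/2}` at each step (`le_of_sqrt_decrease`). This takes
`O(ε^{-(3τ - 1/2)})` iterations, within the claimed `O(ε^{-(4τ - 1)})`, and for `τ = 1/2` both exponents
are `-1 = -2τ`.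
-/

/-! ### Smoothness along line segments -/

/-- A non-negative function on the line with `h'' ≤ k² h` cannot decrease at a rate faster than `k h`:
the function `(h' + k h) e^{-k t}` is antitone, so if it were negative at `0`, then `h e^{k t}` would
decrease at least linearly and `h` would become negative. -/
theorem neg_mul_le_deriv_of_deriv2_le {h h' h'' : ℝ → ℝ} {k : ℝ} (hk : 0 ≤ k)
    (hd : ∀ t, HasDerivAt h (h' t) t) (hd' : ∀ t, HasDerivAt h' (h'' t) t)
    (hle : ∀ t, h'' t ≤ k ^ 2 * h t) (h0 : ∀ t, 0 ≤ h t) : -(k * h 0) ≤ h' 0 := by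
  by_contra! hlt
  set w : ℝ → ℝ := fun t => (h' t + k * h t) * Real.exp (-(k * t)) with hw
  have hexp : ∀ (c t : ℝ), HasDerivAt (fun t => Real.exp (c * t)) (Real.exp (c * t) * c) t :=
    fun c t => by simpa using ((hasDerivAt_id t).const_mul c).exp
  have hwd : ∀ t, HasDerivAt w ((h'' t - k ^ 2 * h t) * Real.exp (-(k * t))) t := fun t => by
    have h1 := ((hd' t).add ((hd t).const_mul k)).mul (hexp (-k) t)
    simp only [neg_mul] at h1
    refine h1.congr_deriv ?_
    simp only [Pi.add_apply]
    ring
  have hwa : Antitone w := antitone_of_hasDerivAt_nonpos hwd fun t =>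
    mul_nonpos_of_nonpos_of_nonneg (by simpa using hle t) (Real.exp_pos _).le
  have hw0 : w 0 < 0 := by simp [hw]; linarith
  set z : ℝ → ℝ := fun t => h t * Real.exp (k * t) - w 0 * t with hz
  have hzd : ∀ t, HasDerivAt z (w t * Real.exp (k * t) ^ 2 - w 0) t := fun t => by
    have h1 := ((hd t).mul (hexp k t)).sub ((hasDerivAt_id t).const_mul (w 0))
    refine h1.congr_deriv ?_
    have : Real.exp (-(k * t)) * Real.exp (k * t) = 1 := by rw [← Real.exp_add]; simp
    simp only [hw]
    linear_combination (-(h' t + k * h t) * Real.exp (k * t)) * this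
  have hza : AntitoneOn z (Set.Ici 0) := by
    refine antitoneOn_of_deriv_nonpos (convex_Ici 0)
      (fun t _ => (hzd t).continuousAt.continuousWithinAt)
      (fun t _ => (hzd t).differentiableAt.differentiableWithinAt) fun t ht => ?_
    have ht : 0 ≤ t := interior_subset ht
    rw [(hzd t).deriv]
    have h1 : w t ≤ w 0 := hwa ht
    have h2 : 1 ≤ Real.exp (k * t) := Real.one_le_exp (by positivity)
    nlinarith [one_le_pow₀ h2 (n := 2)]
  have hT : 0 ≤ (h 0 + 1) / -w 0 := div_nonneg (by linarith [h0 0]) (by linarith)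
  have h1 := hza Set.self_mem_Ici hT hT
  have h2 : w 0 * ((h 0 + 1) / -w 0) = -(h 0 + 1) := by
    have := hw0.ne
    field_simp
  have h3 := mul_nonneg (h0 ((h 0 + 1) / -w 0)) (Real.exp_pos (k * ((h 0 + 1) / -w 0))).le
  simp only [hz, h2] at h1
  simp at h1
  linarith

/-- The smoothness hypothesis for the pair `(∞, 1)`, written without norms: `f` is non-negative, twice
differentiable, and its Hessian maps the cube of radius `r` into the `ℓ₁` ball of radius
`(H₀ + H₁ f) r`. -/
structure SelfBounded {D : ℕ} (H₀ H₁ : ℝ) (f : EuclideanSpace ℝ (Fin D) → ℝ) : Prop where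
  diff : Differentiable ℝ f
  diff_grad : Differentiable ℝ (∇ f)
  nonneg : ∀ θ, 0 ≤ f θ
  hess : ∀ θ x r, 0 ≤ r → (∀ i, |x i| ≤ r) → ∑ i, |hessian f θ x i| ≤ (H₀ + H₁ * f θ) * r

section
variable {D : ℕ} {f : EuclideanSpace ℝ (Fin D) → ℝ} {H₀ H₁ : ℝ}
  {x d : EuclideanSpace ℝ (Fin D)} {r : ℝ}

theorem hasDerivAt_line (x d : EuclideanSpace ℝ (Fin D)) (t : ℝ) :
    HasDerivAt (fun t : ℝ => x + t • d) d t := by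
  simpa using ((hasDerivAt_id t).smul_const d).const_add x

theorem sum_mul_le_of_abs_le {a s : Fin D → ℝ} {r : ℝ} (hs : ∀ i, |s i| ≤ r) :
    ∑ i, a i * s i ≤ r * ∑ i, |a i| := by
  rw [Finset.mul_sum]
  refine Finset.sum_le_sum fun i _ => (le_abs_self _).trans ?_
  rw [abs_mul, mul_comm]
  exact mul_le_mul_of_nonneg_right (hs i) (abs_nonneg _)

theorem abs_line_le {d : EuclideanSpace ℝ (Fin D)} {r t : ℝ} (hd : ∀ i, |d i| ≤ r) (h0 : 0 ≤ t)
    (h1 : t ≤ 1) (i : Fin D) : |(t • d) i| ≤ r := by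
  simp only [PiLp.smul_apply, smul_eq_mul, abs_mul, abs_of_nonneg h0]
  nlinarith [abs_nonneg (d i), hd i]

namespace SelfBounded

theorem hasDerivAt_line_apply (hf : SelfBounded H₀ H₁ f) (x d : EuclideanSpace ℝ (Fin D)) (t : ℝ) :
    HasDerivAt (fun t : ℝ => f (x + t • d)) (∑ i, ∇ f (x + t • d) i * d i) t := by
  have h1 := (hf.diff (x + t • d)).hasGradientAt.hasFDerivAt.comp_hasDerivAt t
    (hasDerivAt_line x d t)
  refine h1.congr_deriv ?_
  rw [InnerProductSpace.toDual_apply_apply, PiLp.inner_apply]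
  exact Finset.sum_congr rfl fun i _ => by simp [mul_comm]

theorem hasDerivAt_line_grad (hf : SelfBounded H₀ H₁ f) (x d : EuclideanSpace ℝ (Fin D))
    (s : Fin D → ℝ) (t : ℝ) :
    HasDerivAt (fun t : ℝ => ∑ i, ∇ f (x + t • d) i * s i)
      (∑ i, hessian f (x + t • d) d i * s i) t := by
  have h1 : HasDerivAt (fun t : ℝ => ∇ f (x + t • d)) (hessian f (x + t • d) d) t :=
    HasFDerivAt.comp_hasDerivAt (l := ∇ f) t (hf.diff_grad (x + t • d)).hasFDerivAt
      (hasDerivAt_line x d t)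
  refine HasDerivAt.fun_sum fun i _ => HasDerivAt.mul_const ?_ _
  exact (EuclideanSpace.proj (𝕜 := ℝ) i).hasFDerivAt.comp_hasDerivAt t h1

variable (hH₀ : 0 ≤ H₀) (hH₁ : 0 ≤ H₁)
include hH₀ hH₁

theorem weight_nonneg (hf : SelfBounded H₀ H₁ f) (x) : 0 ≤ H₀ + H₁ * f x :=
  add_nonneg hH₀ (mul_nonneg hH₁ (hf.nonneg x))

/-- The weight `H₀ + H₁ f` changes at relative rate at most `√H₁ r` in a direction of sup norm at most
`r`. Multiplying by `H₁` keeps the statement meaningful when `H₁ = 0`. -/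
theorem weight_deriv_le (hf : SelfBounded H₀ H₁ f) (hr : 0 ≤ r) (hd : ∀ i, |d i| ≤ r) :
    H₁ * ∑ i, ∇ f x i * d i ≤ √H₁ * r * (H₀ + H₁ * f x) := by
  have hd' : ∀ i, |(-d) i| ≤ r := fun i => by simpa using hd i
  -- The lower bound on the derivative is applied to the line run backwards.
  have key := neg_mul_le_deriv_of_deriv2_le (k := √H₁ * r)
    (h := fun t => H₀ + H₁ * f (x + t • -d)) (by positivity)
    (fun t => ((hf.hasDerivAt_line_apply x (-d) t).const_mul H₁).const_add H₀)
    (fun t => (hf.hasDerivAt_line_grad x (-d) (-d) t).const_mul H₁)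
    (fun t => by
      have h1 := hf.hess (x + t • -d) (-d) r hr hd'
      have h2 := sum_mul_le_of_abs_le (a := hessian f (x + t • -d) (-d)) hd'
      have h3 : (√H₁ * r) ^ 2 * (H₀ + H₁ * f (x + t • -d))
          = H₁ * (r * ((H₀ + H₁ * f (x + t • -d)) * r)) := by
        rw [mul_pow, Real.sq_sqrt hH₁]; ring
      rw [h3]
      exact mul_le_mul_of_nonneg_left (h2.trans (mul_le_mul_of_nonneg_left h1 hr)) hH₁)
    (fun t => hf.weight_nonneg hH₀ hH₁ _)
  simp at key
  linarith

/-- The weight `H₀ + H₁ f`, which bounds the Hessian, grows at most exponentially with the sup-norm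
distance. Since `d` is arbitrary, it also decays at most exponentially. -/
theorem weight_le (hf : SelfBounded H₀ H₁ f) (hr : 0 ≤ r) (hd : ∀ i, |d i| ≤ r) :
    H₀ + H₁ * f (x + d) ≤ Real.exp (√H₁ * r) * (H₀ + H₁ * f x) := by
  set k := √H₁ * r
  have hder : ∀ t : ℝ, HasDerivAt
      (fun t : ℝ => (H₀ + H₁ * f (x + t • d)) * Real.exp (-k * t))
      ((H₁ * ∑ i, ∇ f (x + t • d) i * d i - k * (H₀ + H₁ * f (x + t • d)))
        * Real.exp (-k * t)) t := fun t => by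
    have h1 : HasDerivAt (fun t => Real.exp (-k * t)) (Real.exp (-k * t) * -k) t := by
      simpa using ((hasDerivAt_id t).const_mul (-k)).exp
    refine ((((hf.hasDerivAt_line_apply x d t).const_mul H₁).const_add H₀).mul h1).congr_deriv ?_
    ring
  have hanti := antitone_of_hasDerivAt_nonpos hder fun t =>
    mul_nonpos_of_nonpos_of_nonneg
      (by simpa using hf.weight_deriv_le (x := x + t • d) hH₀ hH₁ hr hd) (Real.exp_pos _).le
  have h1 := hanti zero_le_one
  simp only [one_smul, zero_smul, add_zero, mul_zero, Real.exp_zero, mul_one] at h1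
  have h2 : Real.exp (-k) * Real.exp k = 1 := by rw [← Real.exp_add]; simp
  calc H₀ + H₁ * f (x + d) = Real.exp k * ((H₀ + H₁ * f (x + d)) * Real.exp (-k)) := by
        linear_combination (-(H₀ + H₁ * f (x + d))) * h2
    _ ≤ _ := mul_le_mul_of_nonneg_left h1 (Real.exp_pos _).le

theorem weight_line_le (hf : SelfBounded H₀ H₁ f) (hr : 0 ≤ r) (hd : ∀ i, |d i| ≤ r) {t : ℝ}
    (h0 : 0 ≤ t) (h1 : t ≤ 1) :
    H₀ + H₁ * f (x + t • d) ≤ Real.exp (√H₁ * r) * (H₀ + H₁ * f x) :=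
  hf.weight_le hH₀ hH₁ hr (abs_line_le hd h0 h1)

theorem grad_line_sub_le (hf : SelfBounded H₀ H₁ f) (hr : 0 ≤ r) (hd : ∀ i, |d i| ≤ r)
    {s : Fin D → ℝ} {R : ℝ} (hR : 0 ≤ R) (hs : ∀ i, |s i| ≤ R) {t : ℝ} (h0 : 0 ≤ t) (h1 : t ≤ 1) :
    ∑ i, ∇ f (x + t • d) i * s i ≤ ∑ i, ∇ f x i * s i
      + R * (Real.exp (√H₁ * r) * (H₀ + H₁ * f x) * r) * t := by
  have hder := hf.hasDerivAt_line_grad x d s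
  have key := Convex.image_sub_le_mul_sub_of_deriv_le (convex_Icc (0 : ℝ) 1)
    (f := fun t : ℝ => ∑ i, ∇ f (x + t • d) i * s i)
    (fun u _ => (hder u).continuousAt.continuousWithinAt)
    (fun u _ => (hder u).differentiableAt.differentiableWithinAt)
    (C := R * (Real.exp (√H₁ * r) * (H₀ + H₁ * f x) * r)) (fun u hu => by
      rw [(hder u).deriv]
      have hu := interior_subset hu
      refine (sum_mul_le_of_abs_le (a := hessian f (x + u • d) d) hs).trans
        (mul_le_mul_of_nonneg_left ((hf.hess _ d r hr hd).trans ?_) hR)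
      exact mul_le_mul_of_nonneg_right (hf.weight_line_le hH₀ hH₁ hr hd hu.1 hu.2) hr)
    0 (by simp) t ⟨h0, h1⟩ h0
  simp at key
  linarith

/-- The `ℓ₁` norm of the gradient is locally Lipschitz for the sup norm. -/
theorem sum_abs_grad_le (hf : SelfBounded H₀ H₁ f) (hr : 0 ≤ r) (hd : ∀ i, |d i| ≤ r) :
    ∑ i, |∇ f (x + d) i| ≤ ∑ i, |∇ f x i| + Real.exp (√H₁ * r) * (H₀ + H₁ * f x) * r := by
  -- Testing against the signs of the new gradient turns its `ℓ₁` norm into a scalar function.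
  set s : Fin D → ℝ := fun i => SignType.sign (∇ f (x + d) i)
  have hs : ∀ i, |s i| ≤ 1 := fun i => by
    rcases lt_trichotomy (∇ f (x + d) i) 0 with h | h | h <;> simp [s, h]
  have h1 := hf.grad_line_sub_le (x := x) hH₀ hH₁ hr hd zero_le_one hs zero_le_one le_rfl
  have h2 := sum_mul_le_of_abs_le (a := (∇ f x).ofLp) hs
  simp only [one_smul, mul_one, one_mul] at h1 h2
  have h3 : ∑ i, |∇ f (x + d) i| = ∑ i, ∇ f (x + d) i * s i :=
    Finset.sum_congr rfl fun i _ => (self_mul_sign _).symm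
  linarith

/-- Descent inequality. The weight at most doubles along the segment, so the second-order term
`(1/2) · 2 (H₀ + H₁ f x) r²` involves only the weight at `x`. -/
theorem apply_add_le (hf : SelfBounded H₀ H₁ f) (hr : 0 ≤ r) (hd : ∀ i, |d i| ≤ r)
    (h2 : Real.exp (√H₁ * r) ≤ 2) :
    f (x + d) ≤ f x + ∑ i, ∇ f x i * d i + (H₀ + H₁ * f x) * r ^ 2 := by
  have hw := hf.weight_nonneg hH₀ hH₁ x
  set G := ∑ i, ∇ f x i * d i
  set w := H₀ + H₁ * f x
  have hder : ∀ t : ℝ, HasDerivAt (fun t : ℝ => f (x + t • d) - G * t - w * r ^ 2 * t ^ 2)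
      (∑ i, ∇ f (x + t • d) i * d i - G - 2 * (w * r ^ 2) * t) t := fun t => by
    refine (((hf.hasDerivAt_line_apply x d t).sub ((hasDerivAt_id t).const_mul G)).sub
      (((hasDerivAt_id t).pow 2).const_mul (w * r ^ 2))).congr_deriv ?_
    simp
    ring
  have hanti : AntitoneOn (fun t : ℝ => f (x + t • d) - G * t - w * r ^ 2 * t ^ 2)
      (Set.Icc 0 1) := by
    refine antitoneOn_of_deriv_nonpos (convex_Icc 0 1)
      (fun t _ => (hder t).continuousAt.continuousWithinAt)
      (fun t _ => (hder t).differentiableAt.differentiableWithinAt) fun t ht => ?_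
    have ht := interior_subset ht
    rw [(hder t).deriv]
    have h1 := hf.grad_line_sub_le (x := x) hH₀ hH₁ hr hd hr hd ht.1 ht.2
    have h3 : r * (Real.exp (√H₁ * r) * w * r) * t ≤ r * (2 * w * r) * t := by
      have := ht.1
      gcongr
    linarith
  have h1 := hanti (by simp) (by simp) zero_le_one
  simp at h1
  linarith

end SelfBounded
end

/-! ### One step of RMSProp -/

/-- An exponential moving sum of quantities that exceed `G` by at most `ρʲ W j` at lag `j` is of order
`G + W`, as long as the forgetting factor `b` beats the growth factor `ρ`. -/
theorem sum_geometric_weight_le {b ρ G W : ℝ} (hb₀ : 0 ≤ b) (hb₁ : b < 1) (hρ : 0 ≤ ρ)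
    (hbρ : b * ρ ≤ (1 + b) / 2) (hG : 0 ≤ G) (hW : 0 ≤ W) {a : ℕ → ℝ} {t : ℕ}
    (ha : ∀ s ∈ Finset.Icc 1 t, a s ≤ G + ρ ^ (t - s) * (W * (t - s : ℕ))) :
    ∑ s ∈ Finset.Icc 1 t, b ^ (t - s) * a s ≤ 4 / (1 - b) ^ 2 * (G + W) := by
  set x := (1 + b) / 2 with hx
  have hx₁ : x < 1 := by linarith
  have hx₀ : 0 ≤ x := by linarith
  have hre : ∀ F : ℕ → ℝ, ∑ s ∈ Finset.Icc 1 t, F (t - s) = ∑ j ∈ Finset.range t, F j := fun F =>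
    Finset.sum_nbij' (fun s => t - s) (fun j => t - j)
      (fun s hs => by simp at hs ⊢; omega) (fun j hj => by simp at hj ⊢; omega)
      (fun s hs => by simp at hs ⊢; omega) (fun j hj => by simp at hj ⊢; omega) (fun _ _ => rfl)
  have h1 : ∑ s ∈ Finset.Icc 1 t, b ^ (t - s) * a s
      ≤ ∑ j ∈ Finset.range t, (x ^ j * G + W * (j * x ^ j)) := by
    rw [← hre fun j => x ^ j * G + W * (j * x ^ j)]
    refine Finset.sum_le_sum fun s hs => ?_
    have e1 : b ^ (t - s) ≤ x ^ (t - s) := pow_le_pow_left₀ hb₀ (by linarith) _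
    have e2 : (b * ρ) ^ (t - s) ≤ x ^ (t - s) := pow_le_pow_left₀ (by positivity) hbρ _
    calc b ^ (t - s) * a s
        ≤ b ^ (t - s) * (G + ρ ^ (t - s) * (W * (t - s : ℕ))) := by gcongr; exact ha s hs
      _ = b ^ (t - s) * G + W * ((t - s : ℕ) * (b * ρ) ^ (t - s)) := by rw [mul_pow]; ring
      _ ≤ _ := by gcongr
  have h2 : ∑ j ∈ Finset.range t, x ^ j ≤ (1 - x)⁻¹ :=
    sum_le_hasSum _ (fun _ _ => by positivity) (hasSum_geometric_of_lt_one hx₀ hx₁)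
  have h3 : ∑ j ∈ Finset.range t, (j : ℝ) * x ^ j ≤ x / (1 - x) ^ 2 :=
    sum_le_hasSum _ (fun _ _ => by positivity)
      (hasSum_coe_mul_geometric_of_norm_lt_one (by rwa [Real.norm_of_nonneg hx₀]))
  -- The constant `4 / (1 - b)²` is `1 / (1 - x)²`, which dominates both series.
  have h4 : 4 / (1 - b) ^ 2 = 1 / (1 - x) ^ 2 := by
    have : 1 - x = (1 - b) / 2 := by rw [hx]; ring
    rw [this]; have : 1 - b ≠ 0 := by linarith
    field_simp; norm_num
  have h5 : (1 - x)⁻¹ ≤ 1 / (1 - x) ^ 2 := by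
    rw [inv_eq_one_div]
    exact one_div_le_one_div_of_le (pow_pos (by linarith) 2) (by nlinarith)
  have h6 : x / (1 - x) ^ 2 ≤ 1 / (1 - x) ^ 2 := by gcongr
  rw [Finset.sum_add_distrib, ← Finset.sum_mul, ← Finset.mul_sum] at h1
  rw [h4]
  nlinarith [mul_le_mul_of_nonneg_right (h2.trans h5) hG, mul_le_mul_of_nonneg_left (h3.trans h6) hW]

section
variable {D : ℕ} {f : EuclideanSpace ℝ (Fin D) → ℝ} {β : ℝ} {θ : ℕ → EuclideanSpace ℝ (Fin D)}

theorem mul_abs_grad_le_sqrt_rmsV (hβ₀ : 0 ≤ β) (hβ₁ : β ≤ 1) {t : ℕ} (ht : 1 ≤ t) (i : Fin D) :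
    √(1 - β) * |∇ f (θ t) i| ≤ √(rmsV f β θ t i) := by
  rw [← Real.sqrt_sq_eq_abs, ← Real.sqrt_mul (by linarith)]
  refine Real.sqrt_le_sqrt (mul_le_mul_of_nonneg_left ?_ (by linarith))
  have h := Finset.single_le_sum (f := fun s => β ^ (t - s) * (∇ f (θ s)) i ^ 2)
    (fun s _ => by positivity) (Finset.mem_Icc.2 ⟨ht, le_rfl⟩)
  simpa using h

theorem sqrt_rmsV_le (hβ₀ : 0 ≤ β) (t : ℕ) (i : Fin D) :
    √(rmsV f β θ t i) ≤ ∑ s ∈ Finset.Icc 1 t, √β ^ (t - s) * |∇ f (θ s) i| := by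
  have h0 : ∀ s ∈ Finset.Icc 1 t, 0 ≤ √β ^ (t - s) * |∇ f (θ s) i| := fun s _ => by positivity
  refine Real.sqrt_le_iff.2 ⟨Finset.sum_nonneg h0, ?_⟩
  refine le_trans ?_ (Finset.sum_sq_le_sq_sum_of_nonneg h0)
  have h1 : ∑ s ∈ Finset.Icc 1 t, (√β ^ (t - s) * |∇ f (θ s) i|) ^ 2
      = ∑ s ∈ Finset.Icc 1 t, β ^ (t - s) * (∇ f (θ s)) i ^ 2 :=
    Finset.sum_congr rfl fun s _ => by
      rw [mul_pow, ← pow_mul, mul_comm (t - s), pow_mul, Real.sq_sqrt hβ₀, sq_abs]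
  rw [h1, rmsV]
  exact mul_le_of_le_one_left (Finset.sum_nonneg fun s _ => by positivity) (by linarith)

/-- Cauchy–Schwarz: this is what makes the decrease `∑ gᵢ² / √vᵢ` comparable with the `ℓ₁` norm of the
gradient without any dependence on the dimension. Where `vᵢ = 0`, also `gᵢ = 0`. -/
theorem sq_sum_abs_grad_le (hβ₀ : 0 ≤ β) (hβ₁ : β < 1) {t : ℕ} (ht : 1 ≤ t) :
    (∑ i, |∇ f (θ t) i|) ^ 2
      ≤ (∑ i, ∇ f (θ t) i ^ 2 / √(rmsV f β θ t i)) * ∑ i, √(rmsV f β θ t i) := by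
  refine Finset.sum_sq_le_sum_mul_sum_of_sq_le_mul _ (fun i _ => by positivity)
    (fun i _ => by positivity) fun i _ => ?_
  rw [sq_abs]
  have h1 := mul_abs_grad_le_sqrt_rmsV (f := f) (θ := θ) hβ₀ hβ₁.le ht i
  by_cases hv : √(rmsV f β θ t i) = 0
  · have hw : 0 < √(1 - β) := Real.sqrt_pos.2 (by linarith)
    rw [hv] at h1
    have : |∇ f (θ t) i| ≤ 0 := by
      by_contra! h2
      linarith [mul_pos hw h2]
    simp [abs_nonpos_iff.1 this]
  · rw [div_mul_cancel₀ _ hv]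

namespace IsRMSProp
variable {η : ℝ}

theorem abs_step_le (h : IsRMSProp f β 0 (fun _ => η) θ) (hβ₀ : 0 ≤ β) (hβ₁ : β < 1) (hη : 0 ≤ η)
    {t : ℕ} (ht : 1 ≤ t) (i : Fin D) : |θ (t + 1) i - θ t i| ≤ η * (√(1 - β))⁻¹ := by
  have hw : 0 < √(1 - β) := Real.sqrt_pos.2 (by linarith)
  rw [h t ht i, sub_sub_cancel_left, abs_neg, abs_mul, abs_of_nonneg hη, add_zero, abs_div,
    abs_of_nonneg (Real.sqrt_nonneg _)]
  refine mul_le_mul_of_nonneg_left ?_ hη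
  refine div_le_of_le_mul₀ (Real.sqrt_nonneg _) (by positivity) ?_
  rw [inv_mul_eq_div, le_div_iff₀ hw, mul_comm]
  exact mul_abs_grad_le_sqrt_rmsV hβ₀ hβ₁.le ht i

theorem abs_iterate_sub_le (h : IsRMSProp f β 0 (fun _ => η) θ) (hβ₀ : 0 ≤ β) (hβ₁ : β < 1) (hη : 0 ≤ η)
    {s : ℕ} (hs : 1 ≤ s) (j : ℕ) (i : Fin D) :
    |θ s i - θ (s + j) i| ≤ η * (√(1 - β))⁻¹ * j := by
  induction j with
  | zero => simp
  | succ j ih =>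
    have h1 := h.abs_step_le hβ₀ hβ₁ hη (t := s + j) (by omega) i
    have h2 := abs_sub_le (θ s i) (θ (s + j) i) (θ (s + j + 1) i)
    rw [abs_sub_comm] at h1
    rw [← add_assoc]
    push_cast
    linarith

theorem sum_grad_mul_step (h : IsRMSProp f β 0 (fun _ => η) θ) {t : ℕ} (ht : 1 ≤ t) :
    ∑ i, ∇ f (θ t) i * (θ (t + 1) - θ t) i
      = -(η * ∑ i, ∇ f (θ t) i ^ 2 / √(rmsV f β θ t i)) := by
  rw [Finset.mul_sum, ← Finset.sum_neg_distrib]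
  refine Finset.sum_congr rfl fun i _ => ?_
  rw [PiLp.sub_apply, h t ht i]
  ring

variable {H₀ H₁ : ℝ}

/-- The preconditioner is controlled by the current gradient alone: past gradients differ from it by at
most a multiple of the distance travelled, and the exponential weights forget that difference. -/
theorem sum_sqrt_rmsV_le (h : IsRMSProp f β 0 (fun _ => η) θ) (hf : SelfBounded H₀ H₁ f)
    (hH₀ : 0 ≤ H₀) (hH₁ : 0 ≤ H₁) (hβ₀ : 0 ≤ β) (hβ₁ : β < 1) (hη : 0 ≤ η)
    (hexp : √β * Real.exp (√H₁ * (η * (√(1 - β))⁻¹)) ≤ (1 + √β) / 2) {t : ℕ} :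
    ∑ i, √(rmsV f β θ t i) ≤ 4 / (1 - √β) ^ 2 *
      (∑ i, |∇ f (θ t) i| + (H₀ + H₁ * f (θ t)) * (η * (√(1 - β))⁻¹)) := by
  have hb₁ : √β < 1 := by rw [Real.sqrt_lt' one_pos]; simpa
  refine (Finset.sum_le_sum fun i _ => sqrt_rmsV_le hβ₀ t i).trans ?_
  rw [Finset.sum_comm]
  simp_rw [← Finset.mul_sum]
  refine sum_geometric_weight_le (Real.sqrt_nonneg _) hb₁ (Real.exp_pos _).le hexp
    (Finset.sum_nonneg fun i _ => abs_nonneg _)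
    (mul_nonneg (hf.weight_nonneg hH₀ hH₁ _) (by positivity)) fun s hs => ?_
  rw [Finset.mem_Icc] at hs
  obtain ⟨j, rfl⟩ := Nat.exists_eq_add_of_le hs.2
  have h1 := hf.sum_abs_grad_le (x := θ (s + j)) (d := θ s - θ (s + j))
    (r := η * (√(1 - β))⁻¹ * j) hH₀ hH₁ (by positivity)
    (fun i => h.abs_iterate_sub_le hβ₀ hβ₁ hη hs.1 j i)
  rw [add_sub_cancel] at h1
  refine h1.trans_eq ?_
  rw [Nat.add_sub_cancel_left, ← Real.exp_nat_mul]
  ring_nf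

end IsRMSProp

/-- One step of RMSProp, with a constant `A` depending on `β` only. In the sense of the `ℓ₁` norm of the
gradient, the method behaves like sign descent: a step never raises `f` by more than the second-order
term, and it lowers `f` by `(η / A) ‖∇f‖₁` when the gradient is not too small. -/
theorem exists_rmsProp_descent (hβ₀ : 0 < β) (hβ₁ : β < 1) :
    ∃ A : ℝ, 1 ≤ A ∧ ∀ (D : ℕ) (f : EuclideanSpace ℝ (Fin D) → ℝ) (H₀ H₁ : ℝ), 0 ≤ H₀ → 0 ≤ H₁ →
      SelfBounded H₀ H₁ f → ∀ η : ℝ, 0 < η → A * η * √H₁ ≤ 1 →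
      ∀ θ : ℕ → EuclideanSpace ℝ (Fin D), IsRMSProp f β 0 (fun _ => η) θ → ∀ t, 1 ≤ t →
        f (θ (t + 1)) ≤ f (θ t) + A * η ^ 2 * (H₀ + H₁ * f (θ t)) ∧
        (A * η * (H₀ + H₁ * f (θ t)) ≤ ∑ i, |∇ f (θ t) i| →
          f (θ (t + 1)) ≤ f (θ t) - η / A * ∑ i, |∇ f (θ t) i|) := by
  have hb₀ : 0 < √β := Real.sqrt_pos.2 hβ₀
  have hb₁ : √β < 1 := by rw [Real.sqrt_lt' one_pos]; simpa
  set b := √β with hb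
  set w := (√(1 - β))⁻¹ with hw
  have hw₁ : 1 ≤ w := (one_le_inv₀ (Real.sqrt_pos.2 (by linarith))).2
    (Real.sqrt_le_one.2 (by linarith))
  set S := 4 / (1 - b) ^ 2 with hS
  have hS₁ : 1 ≤ S := by
    rw [hS, le_div_iff₀ (pow_pos (by linarith) 2)]
    nlinarith
  have hq : 1 < (1 + b) / (2 * b) := by rw [lt_div_iff₀ (by positivity)]; linarith
  -- A displacement `η w` with `√H₁ η w ≤ l` changes the weight by a factor that is at most `2`, as the
  -- descent inequality asks, and small enough to be beaten by the forgetting factor `b`.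
  set l := min (Real.log 2) (Real.log ((1 + b) / (2 * b))) with hl
  have hl₀ : 0 < l := lt_min (Real.log_pos one_lt_two) (Real.log_pos hq)
  have hw2 : w ≤ w ^ 2 := by nlinarith
  have hA0 : 0 ≤ w / l := by positivity
  set A := 4 * S * w ^ 2 + w / l with hA
  have hAS : 4 * S * w ^ 2 ≤ A := by linarith
  have hAw2 : w ^ 2 ≤ A := by nlinarith
  have hA4S : 4 * S ≤ A := by nlinarith
  have hA1 : 1 ≤ A := by linarith
  refine ⟨A, hA1, fun D f H₀ H₁ hH₀ hH₁ hf η hη hstep θ hθ t ht => ?_⟩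
  have hkr : √H₁ * (η * w) ≤ l := by
    have h1 : w / l * (η * √H₁) ≤ 1 := by
      nlinarith [show 0 ≤ 4 * S * w ^ 2 * (η * √H₁) by positivity]
    rw [div_mul_eq_mul_div, div_le_one hl₀] at h1
    linarith
  have hexp : ∀ z : ℝ, 0 < z → l ≤ Real.log z → Real.exp (√H₁ * (η * w)) ≤ z := fun z hz hlz =>
    (Real.le_log_iff_exp_le hz).1 (hkr.trans hlz)
  have hexp2 := hexp 2 two_pos (min_le_left _ _)
  have hexpb : b * Real.exp (√H₁ * (η * w)) ≤ (1 + b) / 2 := by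
    have := mul_le_mul_of_nonneg_left (hexp _ (by linarith) (min_le_right _ _)) hb₀.le
    refine this.trans_eq ?_
    field_simp
  have hV := hθ.sum_sqrt_rmsV_le hf hH₀ hH₁ hβ₀.le hβ₁ hη.le hexpb (t := t)
  have hCS := sq_sum_abs_grad_le (f := f) (θ := θ) hβ₀.le hβ₁ ht
  have hdesc := hf.apply_add_le (x := θ t) (d := θ (t + 1) - θ t) (r := η * w) hH₀ hH₁
    (by positivity) (fun i => hθ.abs_step_le hβ₀.le hβ₁ hη.le ht i) hexp2
  rw [add_sub_cancel, hθ.sum_grad_mul_step ht] at hdesc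
  have hh := hf.weight_nonneg hH₀ hH₁ (θ t)
  have hG : 0 ≤ ∑ i, |∇ f (θ t) i| := Finset.sum_nonneg fun i _ => abs_nonneg _
  have hQ : 0 ≤ ∑ i, ∇ f (θ t) i ^ 2 / √(rmsV f β θ t i) :=
    Finset.sum_nonneg fun i _ => by positivity
  set G := ∑ i, |∇ f (θ t) i|
  set Q := ∑ i, ∇ f (θ t) i ^ 2 / √(rmsV f β θ t i)
  set h := H₀ + H₁ * f (θ t)
  refine ⟨?_, fun hsmall => ?_⟩
  · have h1 : w ^ 2 * (η ^ 2 * h) ≤ A * (η ^ 2 * h) := by gcongr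
    nlinarith [mul_nonneg hη.le hQ]
  · have h1 : h * (η * w) ≤ G := by
      have : w * (η * h) ≤ A * (η * h) := by gcongr; linarith
      linarith
    have h2 : G ≤ 2 * S * Q := by
      rcases hG.eq_or_lt with h0 | h0
      · rw [← h0]; positivity
      · have h3 : G * G ≤ G * (2 * S * Q) := by
          calc G * G = G ^ 2 := by ring
            _ ≤ Q * (S * (G + h * (η * w))) := hCS.trans (by gcongr)
            _ ≤ Q * (S * (G + G)) := by gcongr
            _ = _ := by ring
        exact le_of_mul_le_mul_left h3 h0
    have h3 : 4 * S * (h * (η * w) ^ 2) ≤ η * G := by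
      calc 4 * S * (h * (η * w) ^ 2) = 4 * S * w ^ 2 * (η * (η * h)) := by ring
        _ ≤ A * (η * (η * h)) := by gcongr
        _ = η * (A * η * h) := by ring
        _ ≤ η * G := by gcongr
    have h4 : η / A * G ≤ η / (4 * S) * G := by gcongr
    have h5 : η / (4 * S) * G + h * (η * w) ^ 2 ≤ η * Q := by
      have h6 : η * G ≤ η * (2 * S * Q) := by gcongr
      have h7 : 4 * S * (η / (4 * S) * G + h * (η * w) ^ 2) ≤ 4 * S * (η * Q) := by
        have : 4 * S * (η / (4 * S) * G) = η * G := by field_simp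
        rw [mul_add, this]
        linarith
      exact le_of_mul_le_mul_left h7 (by positivity)
    linarith
end

/-! ### Reduction to the pair `(∞, 1)` -/

section
variable {D : ℕ} {p q : ℝ≥0∞}

theorem vecNorm_smul [Fact (1 ≤ p)] (c : ℝ) (x : EuclideanSpace ℝ (Fin D)) :
    vecNorm p (c • x) = |c| * vecNorm p x := by
  simp [vecNorm, WithLp.toLp_smul, norm_smul]

theorem vecNorm_nonneg [Fact (1 ≤ p)] (x : EuclideanSpace ℝ (Fin D)) : 0 ≤ vecNorm p x :=
  norm_nonneg _

theorem abs_apply_le_vecNorm [Fact (1 ≤ p)] (x : EuclideanSpace ℝ (Fin D)) (i : Fin D) :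
    |x i| ≤ vecNorm p x :=
  PiLp.norm_apply_le (WithLp.toLp p x.ofLp : PiLp p fun _ : Fin D => ℝ) i

theorem vecNorm_le_sum_abs [Fact (1 ≤ p)] (x : EuclideanSpace ℝ (Fin D)) :
    vecNorm p x ≤ ∑ i, |x i| := by
  have h : (WithLp.toLp p x.ofLp : PiLp p fun _ : Fin D => ℝ)
      = ∑ i, PiLp.single p (β := fun _ => ℝ) i (x i) := by
    ext j
    simp [Finset.sum_apply, Pi.single_apply]
  rw [vecNorm, h]
  refine (norm_sum_le _ _).trans_eq (Finset.sum_congr rfl fun i _ => ?_)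
  rw [PiLp.norm_single]
  rfl

theorem sum_abs_le_mul_vecNorm [Fact (1 ≤ q)] (x : EuclideanSpace ℝ (Fin D)) :
    ∑ i, |x i| ≤ D * vecNorm q x := by
  simpa using Finset.sum_le_card_nsmul Finset.univ (fun i => |x i|) (vecNorm q x)
    fun i _ => abs_apply_le_vecNorm x i

theorem vecNorm_le_opNorm_mul [Fact (1 ≤ p)] [Fact (1 ≤ q)]
    (A : EuclideanSpace ℝ (Fin D) →L[ℝ] EuclideanSpace ℝ (Fin D))
    (x : EuclideanSpace ℝ (Fin D)) {R : ℝ} (hx : vecNorm p x ≤ R) :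
    vecNorm q (A x) ≤ opNorm p q A * R := by
  have hbdd : BddAbove {r : ℝ | ∃ x : EuclideanSpace ℝ (Fin D),
      vecNorm p x ≤ 1 ∧ r = vecNorm q (A x)} := by
    refine ⟨D * (‖A‖ * D), ?_⟩
    rintro _ ⟨x, hx, rfl⟩
    have h1 : ‖x‖ ≤ D := by
      refine (vecNorm_le_sum_abs (p := 2) x).trans ?_
      refine (sum_abs_le_mul_vecNorm (q := p) x).trans ?_
      exact mul_le_of_le_one_right (Nat.cast_nonneg _) hx
    refine (vecNorm_le_sum_abs _).trans ((sum_abs_le_mul_vecNorm (q := 2) (A x)).trans ?_)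
    gcongr
    exact (A.le_opNorm x).trans (by gcongr)
  rcases (vecNorm_nonneg (p := p) x).trans hx |>.eq_or_lt with h0 | h0
  · have : x = 0 := by
      ext i
      exact abs_nonpos_iff.1 ((abs_apply_le_vecNorm (p := p) x i).trans (h0 ▸ hx))
    rw [this, ← h0, map_zero]
    simp [vecNorm]
  · have h1 : vecNorm q (A (R⁻¹ • x)) ≤ opNorm p q A := by
      refine le_csSup hbdd ⟨_, ?_, rfl⟩
      rw [vecNorm_smul, abs_of_pos (inv_pos.2 h0), inv_mul_le_one₀ h0]
      exact hx
    rwa [map_smul, vecNorm_smul, abs_of_pos (inv_pos.2 h0), inv_mul_le_iff₀ h0, mul_comm] at h1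

theorem opNorm_nonneg [Fact (1 ≤ p)] [Fact (1 ≤ q)]
    (A : EuclideanSpace ℝ (Fin D) →L[ℝ] EuclideanSpace ℝ (Fin D)) : 0 ≤ opNorm p q A := by
  refine Real.sSup_nonneg ?_
  rintro _ ⟨x, -, rfl⟩
  exact vecNorm_nonneg _

/-- The `∞ → 1` norm is bounded by the `p → q` norm, up to a factor `N²` that is needed only when
`p ≠ ∞`. -/
theorem sum_abs_apply_le (hpq : ENNReal.HolderConjugate p q) {N : ℕ} (hD : p = ∞ ∨ D ≤ N)
    (A : EuclideanSpace ℝ (Fin D) →L[ℝ] EuclideanSpace ℝ (Fin D))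
    (x : EuclideanSpace ℝ (Fin D)) {r : ℝ} (hr : 0 ≤ r) (hx : ∀ i, |x i| ≤ r) :
    ∑ i, |A x i| ≤ (if p = ∞ then 1 else (N : ℝ) ^ 2) * opNorm p q A * r := by
  have : Fact (1 ≤ p) := ⟨ENNReal.HolderConjugate.one_le p q⟩
  have : Fact (1 ≤ q) := ⟨ENNReal.HolderConjugate.one_le q p⟩
  split_ifs with hp
  · subst hp
    obtain rfl : q = 1 := (ENNReal.HolderConjugate.eq_top_iff_eq_one ∞ q).1 rfl
    have h1 : vecNorm ∞ x ≤ r := by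
      rw [vecNorm, PiLp.norm_eq_ciSup]
      exact Real.iSup_le hx hr
    have h2 := vecNorm_le_opNorm_mul (q := 1) A x h1
    rw [vecNorm, PiLp.norm_eq_of_L1] at h2
    simpa using h2
  · have hDN : (D : ℝ) ≤ N := by exact_mod_cast hD.resolve_left hp
    have h1 : vecNorm p x ≤ N * r := by
      refine (vecNorm_le_sum_abs x).trans ?_
      have := Finset.sum_le_card_nsmul Finset.univ (fun i => |x i|) r fun i _ => hx i
      simp only [Finset.card_univ, Fintype.card_fin, nsmul_eq_mul] at this
      exact this.trans (by gcongr)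
    have h2 := vecNorm_le_opNorm_mul (q := q) A x h1
    calc ∑ i, |A x i| ≤ D * vecNorm q (A x) := sum_abs_le_mul_vecNorm _
      _ ≤ N * (opNorm p q A * (N * r)) := mul_le_mul hDN h2 (vecNorm_nonneg _) (by positivity)
      _ = _ := by ring

theorem NonUniformSmooth.selfBounded (hpq : ENNReal.HolderConjugate p q) {N : ℕ}
    (hD : p = ∞ ∨ D ≤ N) {f : EuclideanSpace ℝ (Fin D) → ℝ} {H₀ H₁ : ℝ}
    (hs : NonUniformSmooth p q H₀ H₁ f) (hf : TwiceDiffNonneg f) {K : ℝ}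
    (hK : (if p = ∞ then 1 else (N : ℝ) ^ 2) ≤ K) : SelfBounded (K * H₀) (K * H₁) f where
  diff := hf.1
  diff_grad := hf.2.1
  nonneg := hf.2.2
  hess θ x r hr hx := by
    have : Fact (1 ≤ p) := ⟨ENNReal.HolderConjugate.one_le p q⟩
    have : Fact (1 ≤ q) := ⟨ENNReal.HolderConjugate.one_le q p⟩
    refine (sum_abs_apply_le hpq hD _ x hr hx).trans (mul_le_mul_of_nonneg_right ?_ hr)
    have hK0 : 0 ≤ K := le_trans (by split_ifs <;> positivity) hK
    calc _ ≤ K * (H₀ + H₁ * f θ) := mul_le_mul hK (hs θ) (opNorm_nonneg _) hK0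
      _ = _ := by ring

/-! ### Exponents below one half -/

variable {f : EuclideanSpace ℝ (Fin D) → ℝ} {H₀ H₁ : ℝ}

/-- A non-negative function has a small gradient where it is small: otherwise a step of length `r`
against the signs of the gradient would make it negative. -/
theorem SelfBounded.mul_sum_abs_grad_le (hf : SelfBounded H₀ H₁ f) (hH₀ : 0 ≤ H₀) (hH₁ : 0 ≤ H₁)
    {r : ℝ} (hr : 0 ≤ r) (hexp : Real.exp (√H₁ * r) ≤ 2) (x : EuclideanSpace ℝ (Fin D)) :
    r * ∑ i, |∇ f x i| ≤ f x + (H₀ + H₁ * f x) * r ^ 2 := by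
  set d : EuclideanSpace ℝ (Fin D) := WithLp.toLp 2 fun i => -r * SignType.sign (∇ f x i)
  have hd : ∀ i, |d i| ≤ r := fun i => by
    rcases lt_trichotomy (∇ f x i) 0 with h | h | h <;> simp [d, h, hr, abs_of_nonneg]
  have h1 := hf.apply_add_le (x := x) hH₀ hH₁ hr hd hexp
  have h2 : ∑ i, ∇ f x i * d i = -(r * ∑ i, |∇ f x i|) := by
    rw [Finset.mul_sum, ← Finset.sum_neg_distrib]
    refine Finset.sum_congr rfl fun i _ => ?_
    rw [← self_mul_sign]
    simp only [d]
    ring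
  linarith [hf.nonneg (x + d)]

/-- For `τ < 1/2` the Łojasiewicz inequality forces `f = 0`: near its infimum, `f` satisfies
`‖∇f‖₁ ≤ C √f`, which is incompatible with `μ f^τ ≤ ‖∇f‖₁` at small positive values of `f`, and
a nonzero `f` takes all of these. -/
theorem SelfBounded.eq_zero_of_lojasiewicz (hf : SelfBounded H₀ H₁ f) (hH₀ : 0 ≤ H₀)
    (hH₁ : 0 ≤ H₁) {μ τ : ℝ} (hμ : 0 < μ) (hτ : τ < 1 / 2)
    (hL : ∀ x, μ * f x ^ τ ≤ ∑ i, |∇ f x i|) (hinf : ⨅ x, f x = 0)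
    (x : EuclideanSpace ℝ (Fin D)) : f x = 0 := by
  by_contra hne
  have hx : 0 < f x := (hf.nonneg x).lt_of_ne' hne
  have e1 : ∀ᶠ v : ℝ in nhdsWithin 0 (Set.Ioi 0), (1 + H₀ + H₁) * v ^ (1 / 2 - τ) < μ := by
    have hc : ContinuousAt (fun v : ℝ => (1 + H₀ + H₁) * v ^ (1 / 2 - τ)) 0 :=
      (Real.continuousAt_rpow_const 0 _ (Or.inr (by linarith))).const_mul _
    refine (hc.tendsto.mono_left nhdsWithin_le_nhds).eventually_lt_const ?_
    rw [Real.zero_rpow (by linarith)]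
    simpa
  have e2 : ∀ᶠ v : ℝ in nhdsWithin 0 (Set.Ioi 0), Real.exp (√H₁ * √v) < 2 := by
    have hc : Continuous fun v : ℝ => Real.exp (√H₁ * √v) := by fun_prop
    exact (hc.continuousAt.tendsto.mono_left nhdsWithin_le_nhds).eventually_lt_const (by simp)
  have e3 : ∀ᶠ v : ℝ in nhdsWithin 0 (Set.Ioi 0), v ∈ Set.Ioo 0 (min 1 (f x)) :=
    Ioo_mem_nhdsGT (lt_min one_pos hx)
  obtain ⟨v, h1, h2, hv0, hv⟩ := (e1.and (e2.and e3)).exists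
  obtain ⟨y, hy⟩ := exists_lt_of_ciInf_lt (hinf.trans_lt hv0)
  obtain ⟨z, rfl⟩ := mem_range_of_exists_le_of_exists_ge hf.diff.continuous ⟨y, hy.le⟩
    ⟨x, (hv.trans_le (min_le_right _ _)).le⟩
  have hz1 : f z ≤ 1 := (hv.trans_le (min_le_left _ _)).le
  have h3 := hf.mul_sum_abs_grad_le hH₀ hH₁ (Real.sqrt_nonneg (f z)) h2.le z
  have hs : 0 < √(f z) := Real.sqrt_pos.2 hv0
  have h4 : f z ^ (1 / 2 - τ) * f z ^ τ = √(f z) := by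
    rw [← Real.rpow_add hv0, Real.sqrt_eq_rpow]; ring_nf
  have h5 : √(f z) * (μ * f z ^ τ) ≤ √(f z) * ((1 + H₀ + H₁) * f z ^ (1 / 2 - τ) * f z ^ τ) := by
    calc √(f z) * (μ * f z ^ τ) ≤ f z + (H₀ + H₁ * f z) * √(f z) ^ 2 :=
          (mul_le_mul_of_nonneg_left (hL z) hs.le).trans h3
      _ = (1 + H₀ + H₁ * f z) * f z := by rw [Real.sq_sqrt hv0.le]; ring
      _ ≤ (1 + H₀ + H₁) * f z := by gcongr; exact mul_le_of_le_one_right hH₁ hz1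
      _ = _ := by
        rw [mul_assoc (1 + H₀ + H₁), h4, mul_left_comm, Real.mul_self_sqrt hv0.le]
  have h6 := le_of_mul_le_mul_left h5 hs
  linarith [mul_lt_mul_of_pos_right h1 (Real.rpow_pos_of_pos hv0 τ)]

end

/-! ### Recursions for the function values -/

/-- A sequence that cannot leave `(-∞, ε]` once it is there must be there by the time `T`, if above `ε`
a potential that is at least `m` drops by `l` at each step and `T` such drops would bring it
below `m`. -/
theorem le_of_potential_decrease {y : ℕ → ℝ} {Φ : ℝ → ℝ} {ε l m : ℝ}
    (hstay : ∀ t, 1 ≤ t → y t ≤ ε → y (t + 1) ≤ ε) (hm : ∀ z, ε < z → m ≤ Φ z)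
    (hdec : ∀ t, 1 ≤ t → ε < y t → ε < y (t + 1) → Φ (y (t + 1)) ≤ Φ (y t) - l) {T : ℕ}
    (hT : ε < y 1 → Φ (y 1) - m < T * l) : y (T + 1) ≤ ε := by
  by_contra! hlt
  have habove : ∀ t, t ≤ T → ε < y (T + 1 - t) := by
    intro t
    induction t with
    | zero => simpa
    | succ t ih =>
      intro ht
      by_contra! h
      have h1 := hstay _ (by omega) h
      rw [show T + 1 - (t + 1) + 1 = T + 1 - t by omega] at h1
      linarith [ih (by omega)]
  have hΦ : ∀ t, t ≤ T → Φ (y (t + 1)) ≤ Φ (y 1) - t * l := by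
    intro t
    induction t with
    | zero => simp
    | succ t ih =>
      intro ht
      have h1 := habove (T - t) (by omega)
      have h2 := habove (T - (t + 1)) (by omega)
      rw [show T + 1 - (T - t) = t + 1 by omega] at h1
      rw [show T + 1 - (T - (t + 1)) = t + 1 + 1 by omega] at h2
      have := hdec (t + 1) (by omega) h1 h2
      push_cast
      linarith [ih (by omega)]
  have h1 := habove T le_rfl
  rw [show T + 1 - T = 1 by omega] at h1
  linarith [hT h1, hΦ T le_rfl, hm _ hlt]

/-- If steps from above `ε / 2` do not increase `y`, and steps from below `ε / 2` end below `ε`, then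
`y` stays bounded by `B` and stays below `ε` once it is there. -/
theorem le_bound_and_stay {y : ℕ → ℝ} {ε B : ℝ} (hεB : ε ≤ B) (h1 : y 1 ≤ B)
    (hlow : ∀ t, 1 ≤ t → y t ≤ B → y t ≤ ε / 2 → y (t + 1) ≤ ε)
    (hhigh : ∀ t, 1 ≤ t → y t ≤ B → ε / 2 < y t → y (t + 1) ≤ y t) (t : ℕ) (ht : 1 ≤ t) :
    y t ≤ B ∧ (y t ≤ ε → y (t + 1) ≤ ε) := by
  have hB : y t ≤ B := by
    induction t, ht using Nat.le_induction with
    | base => exact h1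
    | succ t ht ih =>
      rcases le_or_gt (y t) (ε / 2) with h | h
      · exact (hlow t ht ih h).trans hεB
      · exact (hhigh t ht ih h).trans ih
  refine ⟨hB, fun h => ?_⟩
  rcases le_or_gt (y t) (ε / 2) with h' | h'
  · exact hlow t ht hB h'
  · exact (hhigh t ht hB h').trans h

section
variable {y G : ℕ → ℝ} {A B H₀ H₁ μ τ η ε : ℝ}

/-- The regime `H₀ ≤ ε H₁` with a step size independent of `ε`: above `ε / 2` the weight is at most
`3 H₁ y`, and the Łojasiewicz inequality gives a gradient of order `y` since `y ≤ B` and `τ ≤ 1`. So `y`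
decreases geometrically, and `log y` by a constant at each step. -/
theorem le_of_linear_decrease (hA : 1 ≤ A) (hB : 1 ≤ B) (hH₁ : 0 ≤ H₁) (hμ : 0 < μ)
    (hτ₀ : 0 ≤ τ) (hτ₁ : τ ≤ 1) (hη : 0 < η) (hε : 0 < ε) (hεB : ε ≤ B) (hεH : H₀ ≤ ε * H₁)
    (hη₁ : 3 * A * η * H₁ * B ≤ μ) (hη₂ : 3 * A * η ^ 2 * H₁ ≤ 1) (hy₁ : y 1 ≤ B)
    (hup : ∀ t, 1 ≤ t → y (t + 1) ≤ y t + A * η ^ 2 * (H₀ + H₁ * y t))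
    (hdown : ∀ t, 1 ≤ t → A * η * (H₀ + H₁ * y t) ≤ G t → y (t + 1) ≤ y t - η / A * G t)
    (hG : ∀ t, μ * y t ^ τ ≤ G t) {T : ℕ}
    (hT : ε < y 1 → Real.log B - Real.log ε < T * (η * μ / (A * B))) : y (T + 1) ≤ ε := by
  have hlow : ∀ t, 1 ≤ t → y t ≤ B → y t ≤ ε / 2 → y (t + 1) ≤ ε := fun t ht _ h => by
    have h1 : A * η ^ 2 * (H₀ + H₁ * y t) ≤ A * η ^ 2 * (H₁ * (3 * ε / 2)) := by
      gcongr
      nlinarith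
    nlinarith [hup t ht, mul_le_mul_of_nonneg_right hη₂ hε.le]
  have hhigh : ∀ t, 1 ≤ t → y t ≤ B → ε / 2 < y t →
      y (t + 1) ≤ y t * (1 - η * μ / (A * B)) := fun t ht hyB h => by
    have hy0 : 0 < y t := by linarith
    have h1 : y t ≤ B * y t ^ τ := by
      calc y t = y t ^ (1 - τ) * y t ^ τ := by rw [← Real.rpow_add hy0]; simp
        _ ≤ B ^ (1 - τ) * y t ^ τ := by gcongr
        _ ≤ B ^ (1 : ℝ) * y t ^ τ := by gcongr; linarith
        _ = _ := by rw [Real.rpow_one]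
    have h2 : A * η * (H₀ + H₁ * y t) ≤ μ * y t ^ τ := by
      calc A * η * (H₀ + H₁ * y t) ≤ A * η * (3 * H₁ * y t) := by gcongr; nlinarith
        _ ≤ A * η * (3 * H₁ * (B * y t ^ τ)) := by gcongr
        _ = 3 * A * η * H₁ * B * y t ^ τ := by ring
        _ ≤ _ := by gcongr
    have h3 : η / A * (μ / B * y t) ≤ η / A * G t := by
      gcongr
      refine le_trans ?_ (hG t)
      rw [div_mul_eq_mul_div, div_le_iff₀ (by linarith)]
      nlinarith [mul_le_mul_of_nonneg_left h1 hμ.le]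
    have h4 : η / A * (μ / B * y t) = y t * (η * μ / (A * B)) := by field_simp
    linarith [hdown t ht (h2.trans (hG t))]
  have hl : 0 ≤ η * μ / (A * B) := by positivity
  have key := le_bound_and_stay hεB hy₁ hlow fun t ht hyB h => (hhigh t ht hyB h).trans
    (mul_le_of_le_one_right (by linarith) (by linarith))
  refine le_of_potential_decrease (Φ := Real.log) (m := Real.log ε) (l := η * μ / (A * B))
    (fun t ht => (key t ht).2) (fun z hz => Real.log_le_log hε hz.le) (fun t ht h h' => ?_)
    fun h => lt_of_le_of_lt ?_ (hT h)
  · have hy0 : 0 < y t := hε.trans h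
    have h1 := hhigh t ht (key t ht).1 (by linarith)
    have h2 : 0 < 1 - η * μ / (A * B) := pos_of_mul_pos_right (hε.trans (h'.trans_le h1)) hy0.le
    calc Real.log (y (t + 1)) ≤ Real.log (y t * (1 - η * μ / (A * B))) :=
          Real.log_le_log (hε.trans h') h1
      _ = Real.log (y t) + Real.log (1 - η * μ / (A * B)) := Real.log_mul hy0.ne' h2.ne'
      _ ≤ _ := by linarith [Real.log_le_sub_one_of_pos h2]
  · linarith [Real.log_le_log (hε.trans h) hy₁]

/-- The regime of step size `c ε^{2τ}`: above `ε / 2` the decrease is of order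
`η y^τ ≥ η ε^{τ - 1/2} √y`, so that `√y` decreases by a constant of order `η ε^{τ - 1/2}` at each step. -/
theorem le_of_sqrt_decrease {c : ℝ} (hA : 1 ≤ A) (hB : 1 ≤ B) (hH₀ : 0 ≤ H₀) (hH₁ : 0 ≤ H₁)
    (hμ : 0 < μ) (hτ₀ : 1 / 2 ≤ τ) (hτ₁ : τ ≤ 1) (hc : 0 < c) (hε : 0 < ε) (hεB : ε ≤ B)
    (hη : η = c * ε ^ (2 * τ)) (hc₁ : 2 * A * c * B * (H₀ + H₁ * B) ≤ μ)
    (hc₂ : 2 * A * c ^ 2 * B ^ 3 * (H₀ + H₁ * B) ≤ 1) (hy₁ : y 1 ≤ B) (hy₀ : ∀ t, 0 ≤ y t)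
    (hup : ∀ t, 1 ≤ t → y (t + 1) ≤ y t + A * η ^ 2 * (H₀ + H₁ * y t))
    (hdown : ∀ t, 1 ≤ t → A * η * (H₀ + H₁ * y t) ≤ G t → y (t + 1) ≤ y t - η / A * G t)
    (hG : ∀ t, μ * y t ^ τ ≤ G t) {T : ℕ}
    (hT : ε < y 1 → √B < T * (η * μ * ε ^ (τ - 1 / 2) / (2 * A))) : y (T + 1) ≤ ε := by
  have hη0 : 0 < η := by rw [hη]; positivity
  have hB0 : 0 < B := by linarith
  have hlow : ∀ t, 1 ≤ t → y t ≤ B → y t ≤ ε / 2 → y (t + 1) ≤ ε := fun t ht hyB h => by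
    have h1 : η ^ 2 ≤ c ^ 2 * B ^ 3 * ε := by
      have e1 : (ε ^ (2 * τ)) ^ 2 = ε ^ (4 * τ - 1) * ε := by
        rw [← Real.rpow_natCast, ← Real.rpow_mul hε.le]
        nth_rw 3 [← Real.rpow_one ε]
        rw [← Real.rpow_add hε]
        congr 1
        push_cast
        ring
      have e2 : ε ^ (4 * τ - 1) ≤ B ^ 3 := by
        calc ε ^ (4 * τ - 1) ≤ B ^ (4 * τ - 1) := by gcongr; linarith
          _ ≤ B ^ (3 : ℝ) := by gcongr; linarith
          _ = B ^ 3 := by norm_cast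
      rw [hη, mul_pow, e1, mul_assoc]
      gcongr
    have h2 : A * η ^ 2 * (H₀ + H₁ * y t) ≤ A * (c ^ 2 * B ^ 3 * ε) * (H₀ + H₁ * B) := by
      have := hy₀ t
      gcongr
    nlinarith [hup t ht, mul_le_mul_of_nonneg_right hc₂ hε.le]
  have hhigh : ∀ t, 1 ≤ t → y t ≤ B → ε / 2 < y t →
      y (t + 1) ≤ y t - η / A * (μ * y t ^ τ) := fun t ht hyB h => by
    have hy0 : 0 < y t := by linarith
    have h1 : ε ^ (2 * τ) ≤ B * (2 * y t ^ τ) := by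
      calc ε ^ (2 * τ) = ε ^ τ * ε ^ τ := by rw [← Real.rpow_add hε]; ring_nf
        _ ≤ B ^ τ * (2 * y t) ^ τ := by gcongr; linarith
        _ = B ^ τ * (2 ^ τ * y t ^ τ) := by rw [Real.mul_rpow zero_le_two hy0.le]
        _ ≤ B ^ (1 : ℝ) * (2 ^ (1 : ℝ) * y t ^ τ) := by gcongr; exact one_le_two
        _ = _ := by simp
    have h2 : A * η * (H₀ + H₁ * y t) ≤ μ * y t ^ τ := by
      calc A * η * (H₀ + H₁ * y t) ≤ A * (c * (B * (2 * y t ^ τ))) * (H₀ + H₁ * B) := by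
            rw [hη]; gcongr
        _ = 2 * A * c * B * (H₀ + H₁ * B) * y t ^ τ := by ring
        _ ≤ _ := by gcongr
    have h3 : η / A * (μ * y t ^ τ) ≤ η / A * G t := by gcongr; exact hG t
    linarith [hdown t ht (h2.trans (hG t))]
  have key := le_bound_and_stay hεB hy₁ hlow fun t ht hyB h => (hhigh t ht hyB h).trans
    (sub_le_self _ (mul_nonneg (by positivity) (mul_nonneg hμ.le (Real.rpow_nonneg (hy₀ t) _))))
  refine le_of_potential_decrease (Φ := Real.sqrt) (m := 0)
    (l := η * μ * ε ^ (τ - 1 / 2) / (2 * A))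
    (fun t ht => (key t ht).2) (fun z _ => Real.sqrt_nonneg z) (fun t ht h h' => ?_)
    fun h => lt_of_le_of_lt ?_ (hT h)
  · have hy0 : 0 < y t := hε.trans h
    have hs : 0 < √(y t) := Real.sqrt_pos.2 hy0
    have h1 := hhigh t ht (key t ht).1 (by linarith)
    set l := η * μ * ε ^ (τ - 1 / 2) / (2 * A) with hl
    have h2 : √(y t) * ε ^ (τ - 1 / 2) ≤ y t ^ τ := by
      calc √(y t) * ε ^ (τ - 1 / 2) ≤ √(y t) * y t ^ (τ - 1 / 2) := by gcongr
        _ = y t ^ τ := by rw [Real.sqrt_eq_rpow, ← Real.rpow_add hy0]; ring_nf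
    have h3 : 2 * l * √(y t) ≤ η / A * (μ * y t ^ τ) := by
      calc 2 * l * √(y t) = η / A * (μ * (√(y t) * ε ^ (τ - 1 / 2))) := by rw [hl]; field_simp
        _ ≤ _ := by gcongr
    have h4 : √(y t) ^ 2 = y t := Real.sq_sqrt hy0.le
    have h5 : 2 * l ≤ √(y t) := by
      have := hy₀ (t + 1)
      exact le_of_mul_le_mul_right (by nlinarith : 2 * l * √(y t) ≤ √(y t) * √(y t)) hs
    refine Real.sqrt_le_iff.2 ⟨?_, ?_⟩
    · have : 0 ≤ l := by positivity
      linarith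
    · nlinarith [sq_nonneg l]
  · linarith [Real.sqrt_le_sqrt hy₁]

theorem sqrt_lt_mul_of_rpow_le {c T : ℝ} (hA : 0 < A) (hB : 1 ≤ B) (hμ : 0 < μ) (hτ₀ : 1 / 2 ≤ τ)
    (hτ₁ : τ ≤ 1) (hc : 0 < c) (hε : 0 < ε) (hεB : ε ≤ B)
    (hT : 4 * A * B / (c * μ) * (1 / ε ^ (4 * τ - 1)) ≤ T) :
    √B < T * (c * ε ^ (2 * τ) * μ * ε ^ (τ - 1 / 2) / (2 * A)) := by
  have hB0 : 0 < B := by linarith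
  have hsB : 0 < √B := Real.sqrt_pos.2 hB0
  have h1 : ε ^ (2 * τ) * ε ^ (τ - 1 / 2) * ε ^ (τ - 1 / 2) = ε ^ (4 * τ - 1) := by
    rw [← Real.rpow_add hε, ← Real.rpow_add hε]; ring_nf
  have h2 : ε ^ (τ - 1 / 2) ≤ √B := by
    calc ε ^ (τ - 1 / 2) ≤ B ^ (τ - 1 / 2) := by gcongr
      _ ≤ B ^ (1 / 2 : ℝ) := by gcongr; linarith
      _ = √B := (Real.sqrt_eq_rpow B).symm
  have hp : 0 < ε ^ (τ - 1 / 2) := Real.rpow_pos_of_pos hε _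
  have hp' : 0 < ε ^ (2 * τ) := Real.rpow_pos_of_pos hε _
  have h3 : √B < 2 * B / ε ^ (τ - 1 / 2) := by
    rw [lt_div_iff₀ hp]
    nlinarith [Real.mul_self_sqrt hB0.le, mul_le_mul_of_nonneg_left h2 hsB.le]
  refine h3.trans_le (le_trans (le_of_eq ?_) (mul_le_mul_of_nonneg_right hT (by positivity)))
  rw [← h1]
  field_simp
  norm_num

theorem log_sub_log_lt_mul {l T : ℝ} (hB : 1 ≤ B) (hl : 0 < l)
    (hT : (Real.log B + 1) / l * (1 + max 0 (Real.log (1 / ε))) ≤ T) :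
    Real.log B - Real.log ε < T * l := by
  rw [one_div, Real.log_inv] at hT
  have h0 := Real.log_nonneg hB
  have h1 := mul_le_mul_of_nonneg_right hT hl.le
  have h2 : (Real.log B + 1) / l * (1 + max 0 (-Real.log ε)) * l
      = (Real.log B + 1) * (1 + max 0 (-Real.log ε)) := by field_simp
  nlinarith [le_max_left 0 (-Real.log ε), le_max_right 0 (-Real.log ε)]

end

/-! ### The convergence theorem -/

theorem exists_pos_mul_le {u v w μ : ℝ} (hu : 0 ≤ u) (hv : 0 ≤ v) (hw : 0 ≤ w) (hμ : 0 < μ) :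
    ∃ c : ℝ, 0 < c ∧ c ≤ 1 ∧ c * u ≤ 1 ∧ c * v ≤ μ ∧ c * w ≤ 1 := by
  have hv' : 0 ≤ v / μ := by positivity
  have hM : 0 < 1 + u + v / μ + w := by positivity
  have key : ∀ z, z ≤ 1 + u + v / μ + w → (1 + u + v / μ + w)⁻¹ * z ≤ 1 := fun z hz => by
    rwa [inv_mul_le_iff₀ hM, mul_one]
  refine ⟨(1 + u + v / μ + w)⁻¹, inv_pos.2 hM, inv_le_one_of_one_le₀ (by linarith),
    key _ (by linarith), ?_, key _ (by linarith)⟩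
  have h := key (v / μ) (by linarith)
  rwa [← mul_div_assoc, div_le_one hμ] at h

theorem mainTheorem2 (p q : ℝ≥0∞) (hpq : ENNReal.HolderConjugate p q)
    (H₀ H₁ μ τ β F : ℝ) (N : ℕ) (hH₀ : 0 ≤ H₀) (hH₁ : 0 ≤ H₁) (hμ : 0 < μ)
    (hτ₀ : 0 < τ) (hτ₁ : τ ≤ 1) (hβ₀ : 0 < β) (hβ₁ : β < 1) :
    ∃ η₁ > (0 : ℝ), ∃ a > (0 : ℝ), ∃ c > (0 : ℝ), ∃ C > (0 : ℝ),
      ∀ D : ℕ, (p = ∞ ∨ D ≤ N) →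
      ∀ f : EuclideanSpace ℝ (Fin D) → ℝ,
        TwiceDiffNonneg f → NonUniformSmooth p q H₀ H₁ f →
        NonUniformLojasiewicz q τ (fun _ => μ) f → (⨅ x, f x) = 0 →
      ∀ θ : ℕ → EuclideanSpace ℝ (Fin D), f (θ 1) ≤ F →
      ∀ ε : ℝ, 0 < ε →
        (H₀ < ε * H₁ → IsRMSProp f β 0 (fun _ => η₁) θ →
          ∀ T : ℕ, C * (1 + max 0 (Real.log (1 / ε))) ≤ T → f (θ (T + 1)) ≤ ε) ∧
        (ε * H₁ ≤ H₀ → IsRMSProp f β 0 (fun _ => min a (c * ε ^ (2 * τ))) θ →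
          (τ ≤ 1 / 2 → ∀ T : ℕ, C * (1 / ε ^ (2 * τ)) ≤ T → f (θ (T + 1)) ≤ ε) ∧
          (1 / 2 < τ → ∀ T : ℕ, C * (1 / ε ^ (4 * τ - 1)) ≤ T → f (θ (T + 1)) ≤ ε)) := by
  obtain ⟨A, hA, hdesc⟩ := exists_rmsProp_descent hβ₀ hβ₁
  set K : ℝ := if p = ∞ then 1 else (N : ℝ) ^ 2 with hK
  have hK₀ : 0 ≤ K := by rw [hK]; split_ifs <;> positivity
  set L₀ := K * H₀ with hL₀
  set L₁ := K * H₁ with hL₁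
  have hL₀' : 0 ≤ L₀ := mul_nonneg hK₀ hH₀
  have hL₁' : 0 ≤ L₁ := mul_nonneg hK₀ hH₁
  -- All values of `f` along the iterates stay below `B`. The term `H₀ / H₁` makes `H₀ ≤ B H₁` in the
  -- first regime, where `H₁ > 0`.
  set B := max (max F 1) (H₀ / H₁)
  have hFB : F ≤ B := (le_max_left _ _).trans (le_max_left _ _)
  have hB₁ : 1 ≤ B := (le_max_right _ _).trans (le_max_left _ _)
  have hB₀ : 0 < B := by linarith
  have hA₀ : 0 < A := by linarith
  set h := L₀ + L₁ * B
  have hh₀ : 0 ≤ h := by positivity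
  obtain ⟨η₁, hη₁0, hη₁1, hη₁a, hη₁b, hη₁c⟩ := exists_pos_mul_le (u := A * √L₁)
    (v := 3 * A * L₁ * B) (w := 3 * A * L₁) (by positivity) (by positivity) (by positivity) hμ
  obtain ⟨c, hc0, hc1, hca, hcb, hcc⟩ := exists_pos_mul_le (u := A * B ^ 2 * √L₁)
    (v := 2 * A * B * h) (w := 2 * A * B ^ 3 * h) (by positivity) (by positivity)
    (by positivity) hμ
  set l := η₁ * μ / (A * B)
  have hl₀ : 0 < l := by positivity
  have hC₁ : 0 ≤ (Real.log B + 1) / l := div_nonneg (by linarith [Real.log_nonneg hB₁]) hl₀.le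
  have hC₂ : 0 < 4 * A * B / (c * μ) := by positivity
  refine ⟨η₁, hη₁0, c * B ^ (2 * τ), by positivity, c, hc0,
    (Real.log B + 1) / l + 4 * A * B / (c * μ), by positivity, ?_⟩
  intro D hD f hf hsm hloj hinf θ hθ₁ ε hε
  have hself : SelfBounded L₀ L₁ f := hsm.selfBounded hpq hD hf le_rfl
  have hL : ∀ x, μ * f x ^ τ ≤ ∑ i, |∇ f x i| := fun x => by
    have : Fact (1 ≤ q) := ⟨ENNReal.HolderConjugate.one_le q p⟩
    have h1 := (hloj x).2
    rw [hinf, sub_zero] at h1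
    exact h1.trans (vecNorm_le_sum_abs _)
  have hθB := hθ₁.trans hFB
  have hmin₀ : 0 < min ε B := lt_min hε hB₀
  -- Both regimes are run with the accuracy `min ε B`. If it differs from `ε`, it is `B ≥ f (θ 1)`, and
  -- then no iterations are needed to reach it.
  have hmin_eq : min ε B < f (θ 1) → min ε B = ε := fun h =>
    min_eq_left (le_of_not_ge fun h' => by rw [min_eq_right h'] at h; linarith)
  refine ⟨fun hεH hrms T hT => ?_, fun _ hrms => ?_⟩
  · have hH₁' : 0 < H₁ := hH₁.lt_of_ne' fun h0 => by simp [h0] at hεH; linarith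
    have hmin : H₀ ≤ min ε B * H₁ := by
      rw [min_mul_of_nonneg _ _ hH₁]
      exact le_min hεH.le ((div_le_iff₀ hH₁').1 (le_max_right _ _))
    have e1 : A * η₁ * √L₁ ≤ 1 := by linarith
    have e2 : 3 * A * η₁ * L₁ * B ≤ μ := by linarith
    have e3 : 3 * A * η₁ ^ 2 * L₁ ≤ 1 := by
      have := mul_le_one₀ hη₁1 (by positivity) hη₁c
      linarith
    have hd := hdesc D f L₀ L₁ hL₀' hL₁' hself η₁ hη₁0 e1 θ hrms
    refine (le_of_linear_decrease (y := fun t => f (θ t)) (G := fun t => ∑ i, |∇ f (θ t) i|)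
      hA hB₁ hL₁' hμ hτ₀.le hτ₁ hη₁0 hmin₀ (min_le_right _ _) ?_ e2 e3 hθB
      (fun t ht => (hd t ht).1) (fun t ht => (hd t ht).2) (fun t => hL _) fun h => ?_).trans
      (min_le_left _ _)
    · rw [hL₀, hL₁, mul_left_comm]
      exact mul_le_mul_of_nonneg_left hmin hK₀
    · rw [hmin_eq h]
      refine log_sub_log_lt_mul hB₁ hl₀ (le_trans ?_ hT)
      gcongr
      exact le_add_of_nonneg_right hC₂.le
  · rcases lt_or_ge τ (1 / 2) with hτ | hτ
    · have h0 := hself.eq_zero_of_lojasiewicz hL₀' hL₁' hμ hτ hL hinf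
      exact ⟨fun _ T _ => by rw [h0]; exact hε.le, fun _ T _ => by rw [h0]; exact hε.le⟩
    have key : ∀ T : ℕ, ((Real.log B + 1) / l + 4 * A * B / (c * μ)) * (1 / ε ^ (4 * τ - 1)) ≤ T →
        f (θ (T + 1)) ≤ ε := fun T hT => by
      -- The cap `a = c B^{2τ}` makes the step size that of the accuracy `min ε B`.
      have hη : min (c * B ^ (2 * τ)) (c * ε ^ (2 * τ)) = c * (min ε B) ^ (2 * τ) := by
        rw [← mul_min_of_nonneg _ _ hc0.le, min_comm]
        congr 1
        rcases le_total ε B with h | h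
        · rw [min_eq_left h, min_eq_left (by gcongr)]
        · rw [min_eq_right h, min_eq_right (by gcongr)]
      rw [hη] at hrms
      have e1 : A * (c * (min ε B) ^ (2 * τ)) * √L₁ ≤ 1 := by
        have e : (min ε B) ^ (2 * τ) ≤ B ^ 2 := by
          calc (min ε B) ^ (2 * τ) ≤ B ^ (2 * τ) := by gcongr; exact min_le_right _ _
            _ ≤ B ^ (2 : ℝ) := by gcongr; linarith
            _ = B ^ 2 := by norm_cast
        calc A * (c * (min ε B) ^ (2 * τ)) * √L₁ ≤ A * (c * B ^ 2) * √L₁ := by gcongr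
          _ = c * (A * B ^ 2 * √L₁) := by ring
          _ ≤ 1 := hca
      have e2 : 2 * A * c * B * h ≤ μ := by linarith
      have e3 : 2 * A * c ^ 2 * B ^ 3 * h ≤ 1 := by
        have := mul_le_one₀ hc1 (by positivity) hcc
        linarith
      have hd := hdesc D f L₀ L₁ hL₀' hL₁' hself _ (by positivity) e1 θ hrms
      refine (le_of_sqrt_decrease (y := fun t => f (θ t)) (G := fun t => ∑ i, |∇ f (θ t) i|)
        hA hB₁ hL₀' hL₁' hμ hτ hτ₁ hc0 hmin₀ (min_le_right _ _) rfl e2 e3 hθB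
        (fun t => hf.2.2 _) (fun t ht => (hd t ht).1) (fun t ht => (hd t ht).2)
        (fun t => hL _) fun h => ?_).trans (min_le_left _ _)
      have hεB : ε ≤ B := by rw [← hmin_eq h]; exact min_le_right _ _
      rw [hmin_eq h]
      refine sqrt_lt_mul_of_rpow_le hA₀ hB₁ hμ hτ hτ₁ hc0 hε hεB (le_trans ?_ hT)
      gcongr
      linarith
    refine ⟨fun hτ' T hT => key T ?_, fun _ => key⟩
    rwa [show 4 * τ - 1 = 2 * τ by linarith]
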